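/- Let $q$ be an odd prime power and let $\psi:\mathbb F_q\to\mathbb C^\times$ be a non-trivial additive character. Let $(U,\beta)$ be a two-dimensional $\mathbb F_q$-vector space with a non-degenerate symmetric bilinear form, let $V=\mathbb F_q^2$ with the symplectic form $\langle v,v'\rangle_V=v_1v_2'-v_2v_1'$, and equip $W=U\otimes V$ with the symplectic form $\langle\,,\rangle=\beta\otimes\langle\,,\rangle_V$. Let $\mathrm{Heis}(W)=W\times\mathbb F_q$ be the Heisenberg group, with the law $(w,z)(w',z')=(w+w',z+z'+\tfrac12\langle w,w'\rangle)$, on which $Sp(W)$ acts by $g(w,z)=(gw,z)$. A Heisenberg representation is an irreducible complex representation $\pi$ of $\mathrm{Heis}(W)$ such that every $(0,z)$ acts as the scalar $\psi(z)$; an oscillator representation is a representation $\omega=\omega_{U\otimes V}$ of $Sp(W)$ on the space of such a $\pi$ with $$\omega(g)\pi(h)\omega(g)^{-1}=\pi(g(h))\qquad\text{for all } g\in Sp(W),\ h\in \mathrm{Heis}(W).$$ Such a pair $(\pi,\omega)$ exists, and for every such pair the restriction of $\omega$ to $G=SL_2(\mathbb F_q)=Sp(V)$, along $g\mapsto \mathrm{id}_U\otimes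 g$, has intertwining number $$(\omega_{U\otimes V},\omega_{U\otimes V})_G=\dim_{\mathbb C}\mathrm{End}_G(\omega_{U\otimes V})=2q+1.$$ The number of orbits of the diagonal action of $G$ on $V\times V$ is also $2q+1$. -/

import Mathlib

open scoped TensorProduct MatrixGroups

noncomputable section

/-- The Heisenberg group `W × F` attached to a vector space `W` with a bilinear form `B`. -/
@[ext]
structure Heisenberg {F W : Type*} [Field F] [AddCommGroup W] [Module F W]
    (B : LinearMap.BilinForm F W) where
  /-- The component in `W`. -/
  vec : W
  /-- The central component. -/
  ctr : F

namespace Heisenberg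

variable {F W : Type*} [Field F] [AddCommGroup W] [Module F W] {B : LinearMap.BilinForm F W}

/-- `(w, z) (w', z') = (w + w', z + z' + (1/2) ⟨w, w'⟩)`. -/
instance : Mul (Heisenberg B) :=
  ⟨fun h k => ⟨h.vec + k.vec, h.ctr + k.ctr + 2⁻¹ * B h.vec k.vec⟩⟩

instance : One (Heisenberg B) := ⟨⟨0, 0⟩⟩

/-- For an alternating form the correction term `B w w` vanishes and the inverse of `(w, z)` is
`(-w, -z)`. -/
instance : Inv (Heisenberg B) := ⟨fun h => ⟨-h.vec, -h.ctr + 2⁻¹ * B h.vec h.vec⟩⟩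

@[simp] theorem mul_vec (h k : Heisenberg B) : (h * k).vec = h.vec + k.vec := rfl

@[simp] theorem mul_ctr (h k : Heisenberg B) :
    (h * k).ctr = h.ctr + k.ctr + 2⁻¹ * B h.vec k.vec := rfl

@[simp] theorem one_vec : (1 : Heisenberg B).vec = 0 := rfl

@[simp] theorem one_ctr : (1 : Heisenberg B).ctr = 0 := rfl

@[simp] theorem inv_vec (h : Heisenberg B) : h⁻¹.vec = -h.vec := rfl

@[simp] theorem inv_ctr (h : Heisenberg B) : h⁻¹.ctr = -h.ctr + 2⁻¹ * B h.vec h.vec := rfl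

instance : Group (Heisenberg B) :=
  Group.ofLeftAxioms
    (fun a b c => by
      ext
      · simp [add_assoc]
      · simp only [mul_ctr, mul_vec, map_add, LinearMap.add_apply]; ring)
    (fun a => by ext <;> simp)
    (fun a => by ext <;> simp)

end Heisenberg

/-- The group `Sp(W)` of linear automorphisms of `W` that preserve the form `B`. -/
def Sp {F W : Type*} [Field F] [AddCommGroup W] [Module F W] (B : LinearMap.BilinForm F W) :
    Subgroup (W ≃ₗ[F] W) where
  carrier := {g | ∀ x y, B (g x) (g y) = B x y}
  mul_mem' := by
    intro a b ha hb x y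
    simp only [Set.mem_ofPred_eq] at ha hb
    simp [LinearEquiv.mul_apply, ha, hb]
  one_mem' := fun _ _ => rfl
  inv_mem' := by
    intro a ha x y
    have h := ha (a⁻¹ x) (a⁻¹ y)
    rw [← LinearEquiv.mul_apply, ← LinearEquiv.mul_apply, mul_inv_cancel] at h
    exact h.symm

/-- `Sp(W)` acts on the Heisenberg group by the automorphisms `g (w, z) = (g w, z)`. -/
def spAct {F W : Type*} [Field F] [AddCommGroup W] [Module F W] {B : LinearMap.BilinForm F W}
    (g : Sp B) : Heisenberg B →* Heisenberg B where
  toFun h := ⟨(g : W ≃ₗ[F] W) h.vec, h.ctr⟩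
  map_one' := by ext <;> simp
  map_mul' h k := by
    ext
    · simp
    · simp [g.2 h.vec k.vec]

/-- `π` is (a realization of) the Heisenberg representation with central character `ψ`:
it is irreducible, and the center acts through `ψ`. -/
structure IsHeisenbergRep {F W : Type*} [Field F] [AddCommGroup W] [Module F W]
    {B : LinearMap.BilinForm F W} (ψ : AddChar F ℂ) {H : Type*} [AddCommGroup H] [Module ℂ H]
    (π : Representation ℂ (Heisenberg B) H) : Prop where
  irreducible : π.IsIrreducible
  central : ∀ (z : F) (v : H), π ⟨0, z⟩ v = ψ z • v

/-- `ω` is an oscillator representation of `Sp(W)` on the space of the Heisenberg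
representation `π`: `ω(g) π(h) ω(g)⁻¹ = π(g(h))` for all `g` and `h`. -/
def IsOscillatorRep {F W : Type*} [Field F] [AddCommGroup W] [Module F W]
    {B : LinearMap.BilinForm F W} {H : Type*} [AddCommGroup H] [Module ℂ H]
    (π : Representation ℂ (Heisenberg B) H) (ω : Representation ℂ (Sp B) H) : Prop :=
  ∀ (g : Sp B) (h : Heisenberg B), ω g * π h * ω g⁻¹ = π (spAct g h)

/-- The intertwining number `dim Hom(ρ, σ)` of two representations of a group. -/
def intertwiningNumber {G H K : Type*} [Group G] [AddCommGroup H] [Module ℂ H]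
    [AddCommGroup K] [Module ℂ K] (ρ : Representation ℂ G H) (σ : Representation ℂ G K) : ℕ :=
  Module.finrank ℂ (Representation.IntertwiningMap ρ σ)

/-- The standard symplectic form `⟨v, v'⟩ = v₀ v'₁ - v₁ v'₀` on the plane `V = F²`. -/
def planeForm (F : Type*) [Field F] : LinearMap.BilinForm F (Fin 2 → F) :=
  Matrix.toBilin' !![0, 1; -1, 0]

theorem planeForm_apply {F : Type*} [Field F] (v w : Fin 2 → F) :
    planeForm F v w = v 0 * w 1 - v 1 * w 0 := by
  simp [planeForm, Matrix.toBilin'_apply', Matrix.mulVec, dotProduct, Fin.sum_univ_two]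
  ring

/-- The form `β ⊗ ⟨ , ⟩` on `U ⊗ V`. -/
def tensorForm {F U : Type*} [Field F] [AddCommGroup U] [Module F U]
    (β : LinearMap.BilinForm F U) : LinearMap.BilinForm F (U ⊗[F] (Fin 2 → F)) :=
  LinearMap.BilinForm.tmul β (planeForm F)

theorem tensorForm_tmul {F U : Type*} [Field F] [AddCommGroup U] [Module F U]
    (β : LinearMap.BilinForm F U) (u u' : U) (v v' : Fin 2 → F) :
    tensorForm β (u ⊗ₜ v) (u' ⊗ₜ v') = β u u' * planeForm F v v' := by
  simp [tensorForm, mul_comm]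

theorem planeForm_sl {F : Type*} [Field F] (g : SL(2, F)) (v w : Fin 2 → F) :
    planeForm F (Matrix.SpecialLinearGroup.toLin' g v) (Matrix.SpecialLinearGroup.toLin' g w) =
      planeForm F v w := by
  have h := g.2
  rw [Matrix.det_fin_two] at h
  simp only [planeForm_apply, Matrix.SpecialLinearGroup.toLin'_apply, Matrix.toLin'_apply,
    Matrix.mulVec, dotProduct, Fin.sum_univ_two]
  linear_combination (v 0 * w 1 - v 1 * w 0) * h

/-- The homomorphism `SL₂(F) → Sp(U ⊗ V)`, `g ↦ id ⊗ g`. -/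
def slToSp {F U : Type*} [Field F] [AddCommGroup U] [Module F U] (β : LinearMap.BilinForm F U) :
    SL(2, F) →* Sp (tensorForm β) where
  toFun g := ⟨(Matrix.SpecialLinearGroup.toLin' g).lTensor U, by
    intro x y
    induction x using TensorProduct.induction_on with
    | zero => simp
    | add a b ha hb => simp only [map_add, LinearMap.add_apply, ha, hb]
    | tmul u v =>
      induction y using TensorProduct.induction_on with
      | zero => simp
      | add a b ha hb => simp only [map_add, ha, hb]
      | tmul u' v' =>
        simp only [LinearEquiv.lTensor_tmul, tensorForm_tmul, planeForm_sl]⟩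
  map_one' := by
    apply Subtype.ext
    apply LinearEquiv.toLinearMap_injective
    apply TensorProduct.ext'
    intro u v
    simp
  map_mul' g k := by
    apply Subtype.ext
    apply LinearEquiv.toLinearMap_injective
    apply TensorProduct.ext'
    intro u v
    simp

/-- The orbit of `(u, v)` under the diagonal action of `SL₂(F)` on `V × V`. -/
def diagOrbit {F : Type*} [Field F] (p : (Fin 2 → F) × (Fin 2 → F)) :
    Set ((Fin 2 → F) × (Fin 2 → F)) :=
  Set.range fun g : SL(2, F) =>
    (Matrix.SpecialLinearGroup.toLin' g p.1, Matrix.SpecialLinearGroup.toLin' g p.2)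

end

/-!
The Weyl operators `π (w, 0)` have trace zero for `w ≠ 0` and span `End H`, so they form a basis of
it, and conjugation by `ω g` permutes this basis as `g` permutes `W`. Hence
`dim End_G ω = dim (End H)^G` is the number of `G`-orbits on `W`. As a `G`-set, `W = U ⊗ V` is
`V × V`; a pair `(u, v)` of independent vectors is classified by `⟨u, v⟩ ≠ 0`, which gives `q - 1`
orbits, and the dependent pairs form `q + 2` orbits.

For existence, realize `π` on functions on `U`. By the Skolem–Noether theorem each `g ∈ Sp(W)` is
implemented by an operator, unique up to a scalar. The implementers commute with the parity
operator, which implements `-1`, so they preserve the spaces of even and odd functions. The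
dimensions of these differ by one, so `det₊ / det₋` takes the value `c` on a scalar `c`, and the
implementers normalized by `det₊ = det₋` form a representation.
-/

section Representations

open Representation

variable {k G V : Type*} [Field k] [Group G] [AddCommGroup V] [Module k V]

theorem finiteDimensional_of_isIrreducible [Finite G] (ρ : Representation k G V)
    [ρ.IsIrreducible] : FiniteDimensional k V :=
  have : Module.Finite k ρ.asModule := .trans (MonoidAlgebra k G) ρ.asModule
  .equiv ρ.asModuleEquiv

theorem nontrivial_of_isIrreducible (ρ : Representation k G V) [ρ.IsIrreducible] : Nontrivial V :=
  have := (irreducible_iff_isSimpleModule_asModule ρ).1 ‹_›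
  have := IsSimpleModule.nontrivial (MonoidAlgebra k G) ρ.asModule
  ρ.asModuleEquiv.symm.toEquiv.nontrivial

theorem asAlgebraHom_mem_span_range (ρ : Representation k G V) (r : MonoidAlgebra k G) :
    ρ.asAlgebraHom r ∈ Submodule.span k (Set.range ρ) := by
  rw [asAlgebraHom_def, MonoidAlgebra.lift_apply]
  exact sum_mem fun g _ => Submodule.smul_mem _ _ (Submodule.subset_span (Set.mem_range_self g))

/-- Burnside's theorem, from Schur's lemma and the Jacobson density theorem. -/
theorem span_range_eq_top_of_isIrreducible [IsAlgClosed k] [FiniteDimensional k V]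
    (ρ : Representation k G V) [ρ.IsIrreducible] : Submodule.span k (Set.range ρ) = ⊤ := by
  let R := MonoidAlgebra k G
  have : Module.Finite k ρ.asModule := .equiv ρ.asModuleEquiv.symm
  have : IsSimpleModule R ρ.asModule := (irreducible_iff_isSimpleModule_asModule ρ).1 ‹_›
  have : Module.Finite (Module.End R ρ.asModule) ρ.asModule := .of_restrictScalars_finite k _ _
  have schur := IsSimpleModule.algebraMap_end_bijective_of_isAlgClosed k (A := R) (V := ρ.asModule)
  refine eq_top_iff.2 fun T _ => ?_
  let T' : Module.End (Module.End R ρ.asModule) ρ.asModule :=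
    { toFun := T
      map_add' := map_add T
      map_smul' := fun f v => by
        obtain ⟨c, rfl⟩ := schur.2 f
        exact map_smul T c v }
  obtain ⟨r, hr⟩ := Module.Finite.toModuleEnd_moduleEnd_surjective T'
  rw [show T = ρ.asAlgebraHom r from LinearMap.ext fun v => (DFunLike.congr_fun hr v).symm]
  exact asAlgebraHom_mem_span_range ρ r

theorem exists_eq_smul_one_of_commute [IsAlgClosed k] [FiniteDimensional k V]
    (ρ : Representation k G V) [ρ.IsIrreducible] {T : Module.End k V}
    (hT : ∀ g, Commute T (ρ g)) : ∃ c : k, T = c • 1 := by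
  obtain ⟨c, hc⟩ := IsIrreducible.algebraMap_intertwiningMap_bijective_of_isAlgClosed.2
    (⟨T, hT⟩ : ρ.IntertwiningMap ρ)
  exact ⟨c, congrArg IntertwiningMap.toLinearMap hc.symm⟩

variable {X : Type*} [MulAction G X] {ρ : Representation k G V} {b : Module.Basis X k V}

theorem repr_smul_of_permutes_basis (hb : ∀ g x, ρ g (b x) = b (g • x)) (g : G) (v : V) (x : X) :
    b.repr (ρ g v) (g • x) = b.repr v x := by
  classical
  have : Finsupp.lapply (g • x) ∘ₗ b.repr.toLinearMap ∘ₗ ρ g =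
      Finsupp.lapply x ∘ₗ b.repr.toLinearMap :=
    b.ext fun y => by simp [hb, Finsupp.single_apply]
  exact LinearMap.congr_fun this v

theorem mem_invariants_iff_repr_smul (hb : ∀ g x, ρ g (b x) = b (g • x)) {v : V} :
    v ∈ ρ.invariants ↔ ∀ (g : G) (x : X), b.repr v (g • x) = b.repr v x := by
  rw [mem_invariants]
  refine forall_congr' fun g => ?_
  rw [← b.repr.injective.eq_iff, DFunLike.ext_iff, (MulAction.surjective g).forall]
  exact forall_congr' fun x => by rw [repr_smul_of_permutes_basis hb, eq_comm]

theorem finrank_invariants_eq_card_orbits [Finite X] (hb : ∀ g x, ρ g (b x) = b (g • x)) :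
    Module.finrank k ρ.invariants = Nat.card (MulAction.orbitRel.Quotient G X) := by
  have := Fintype.ofFinite X
  have := Fintype.ofFinite (MulAction.orbitRel.Quotient G X)
  let mk : X → MulAction.orbitRel.Quotient G X := Quotient.mk _
  let L : (MulAction.orbitRel.Quotient G X → k) →ₗ[k] V :=
    b.equivFun.symm.toLinearMap ∘ₗ LinearMap.funLeft k k mk
  have hL : Function.Injective L :=
    b.equivFun.symm.injective.comp
      (LinearMap.funLeft_injective_of_surjective k k mk Quotient.mk_surjective)
  have hrange : LinearMap.range L = ρ.invariants := by
    ext v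
    rw [mem_invariants_iff_repr_smul hb]
    constructor
    · rintro ⟨f, rfl⟩ g x
      have : mk (g • x) = mk x := Quotient.sound ⟨g, rfl⟩
      have hL (y : X) : b.repr (L f) y = f (mk y) :=
        congrFun (b.equivFun.apply_symm_apply fun x => f (mk x)) y
      rw [hL, hL, this]
    · intro hv
      refine ⟨Quotient.lift (b.repr v) fun x y ⟨g, hg⟩ => ?_, ?_⟩
      · rw [← hv g y]; exact congrArg _ hg.symm
      · exact b.equivFun.symm_apply_apply v
  rw [← hrange, LinearMap.finrank_range_of_inj hL, Module.finrank_pi, Nat.card_eq_fintype_card]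

end Representations

namespace Heisenberg

variable {F W : Type*} [Field F] [AddCommGroup W] [Module F W] {B : LinearMap.BilinForm F W}

theorem conj_eq (h2 : (2 : F) ≠ 0) (hB : B.IsAlt) (h k : Heisenberg B) :
    h * k * h⁻¹ = ⟨k.vec, k.ctr + B h.vec k.vec⟩ := by
  ext
  · simp
  · simp only [mul_ctr, mul_vec, inv_vec, inv_ctr, map_add, map_neg, LinearMap.add_apply,
      hB.self_eq_zero, ← hB.neg_eq h.vec k.vec]
    field_simp
    ring

instance [Finite F] [Finite W] : Finite (Heisenberg B) :=
  Finite.of_injective (fun h => (h.vec, h.ctr)) fun _ _ h =>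
    Heisenberg.ext (congrArg Prod.fst h) (congrArg Prod.snd h)

end Heisenberg

section Weyl

variable {F W : Type*} [Field F] [AddCommGroup W] [Module F W] {B : LinearMap.BilinForm F W}
  {ψ : AddChar F ℂ} {H : Type*} [AddCommGroup H] [Module ℂ H]
  {π : Representation ℂ (Heisenberg B) H}

theorem exists_addChar_apply_ne_one (hψ : ψ ≠ 1) (hB : B.SeparatingRight) {x : W} (hx : x ≠ 0) :
    ∃ w, ψ (B w x) ≠ 1 := by
  obtain ⟨a, ha⟩ := AddChar.ne_one_iff.1 hψ
  obtain ⟨w, hw⟩ : ∃ w, B w x ≠ 0 := by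
    contrapose! hx
    exact hB x hx
  exact ⟨(a / B w x) • w, by simpa [hw] using ha⟩

namespace IsHeisenbergRep

theorem finiteDimensional [Finite F] [Finite W] (hπ : IsHeisenbergRep ψ π) :
    FiniteDimensional ℂ H :=
  have := hπ.irreducible
  finiteDimensional_of_isIrreducible π

theorem nontrivial (hπ : IsHeisenbergRep ψ π) : Nontrivial H := by
  have := hπ.irreducible
  exact nontrivial_of_isIrreducible π

theorem apply_eq_smul (hπ : IsHeisenbergRep ψ π) (h : Heisenberg B) :
    π h = ψ h.ctr • π ⟨h.vec, 0⟩ := by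
  have hcentral : π ⟨0, h.ctr⟩ = ψ h.ctr • 1 := LinearMap.ext (hπ.central h.ctr)
  calc π h = π (⟨0, h.ctr⟩ * ⟨h.vec, 0⟩) := by congr 1; ext <;> simp
    _ = _ := by rw [map_mul, hcentral, smul_one_mul]

theorem weyl_mul (hπ : IsHeisenbergRep ψ π) (w x : W) :
    π ⟨w, 0⟩ * π ⟨x, 0⟩ = ψ (2⁻¹ * B w x) • π ⟨w + x, 0⟩ := by
  rw [← map_mul, hπ.apply_eq_smul]
  simp

theorem trace_weyl_eq_zero (hπ : IsHeisenbergRep ψ π) (h2 : (2 : F) ≠ 0) (hψ : ψ ≠ 1)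
    (hB : B.IsAlt) (hB' : B.SeparatingRight) {x : W} (hx : x ≠ 0) :
    LinearMap.trace ℂ H (π ⟨x, 0⟩) = 0 := by
  obtain ⟨w, hw⟩ := exists_addChar_apply_ne_one hψ hB' hx
  have hconj : LinearMap.trace ℂ H (π (⟨w, 0⟩ * ⟨x, 0⟩ * ⟨w, 0⟩⁻¹)) =
      LinearMap.trace ℂ H (π ⟨x, 0⟩) := by
    rw [map_mul, LinearMap.trace_mul_comm, ← map_mul, inv_mul_cancel_left]
  rw [Heisenberg.conj_eq h2 hB, hπ.apply_eq_smul] at hconj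
  simp only [zero_add, map_smul, smul_eq_mul] at hconj
  exact (mul_left_eq_self₀.1 hconj).resolve_left hw

theorem linearIndependent_weyl [FiniteDimensional ℂ H] (hπ : IsHeisenbergRep ψ π)
    (h2 : (2 : F) ≠ 0) (hψ : ψ ≠ 1) (hB : B.IsAlt) (hB' : B.SeparatingRight) :
    LinearIndependent ℂ fun w : W => π ⟨w, 0⟩ := by
  have := hπ.nontrivial
  let dual (x : W) : Module.Dual ℂ (Module.End ℂ H) :=
    (Module.finrank ℂ H : ℂ)⁻¹ • LinearMap.trace ℂ H ∘ₗ LinearMap.mulLeft ℂ (π ⟨-x, 0⟩)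
  refine .of_pairwise_dual_eq_zero_one _ dual (fun x w hxw => ?_) fun x => ?_
  · have : -x + w ≠ 0 := by rwa [neg_add_eq_sub, sub_ne_zero, ne_comm]
    simp [dual, hπ.weyl_mul, hπ.trace_weyl_eq_zero h2 hψ hB hB' this]
  · have : π ⟨0, 0⟩ = 1 := map_one π
    simp [dual, hπ.weyl_mul, hB.self_eq_zero, this, Module.finrank_pos.ne']

theorem span_weyl [FiniteDimensional ℂ H] (hπ : IsHeisenbergRep ψ π) :
    Submodule.span ℂ (Set.range fun w : W => π ⟨w, 0⟩) = ⊤ := by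
  have := hπ.irreducible
  rw [eq_top_iff, ← span_range_eq_top_of_isIrreducible π, Submodule.span_le]
  rintro _ ⟨h, rfl⟩
  rw [hπ.apply_eq_smul]
  exact Submodule.smul_mem _ _ (Submodule.subset_span ⟨h.vec, rfl⟩)

/-- The Weyl operators `π (w, 0)` form a basis of the endomorphism algebra. -/
noncomputable def weylBasis [FiniteDimensional ℂ H] (hπ : IsHeisenbergRep ψ π)
    (h2 : (2 : F) ≠ 0) (hψ : ψ ≠ 1) (hB : B.IsAlt) (hB' : B.SeparatingRight) :
    Module.Basis W ℂ (Module.End ℂ H) :=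
  .mk (hπ.linearIndependent_weyl h2 hψ hB hB') hπ.span_weyl.ge

@[simp]
theorem weylBasis_apply [FiniteDimensional ℂ H] (hπ : IsHeisenbergRep ψ π) (h2 : (2 : F) ≠ 0)
    (hψ : ψ ≠ 1) (hB : B.IsAlt) (hB' : B.SeparatingRight) (w : W) :
    hπ.weylBasis h2 hψ hB hB' w = π ⟨w, 0⟩ := by
  simp [weylBasis]

end IsHeisenbergRep

theorem IsOscillatorRep.intertwiningNumber_eq_card_orbits [FiniteDimensional ℂ H]
    {ω : Representation ℂ (Sp B) H} (hω : IsOscillatorRep π ω) (hπ : IsHeisenbergRep ψ π)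
    (h2 : (2 : F) ≠ 0) (hψ : ψ ≠ 1) (hB : B.IsAlt) (hB' : B.SeparatingRight) [Finite W]
    {G : Type*} [Group G] [MulAction G W] (ρ : G →* Sp B)
    (hρ : ∀ g w, (ρ g : W ≃ₗ[F] W) w = g • w) :
    intertwiningNumber (ω.comp ρ) (ω.comp ρ) = Nat.card (MulAction.orbitRel.Quotient G W) := by
  rw [intertwiningNumber, ← (Representation.invariantsEquivIntertwiningMap _ _).finrank_eq]
  refine finrank_invariants_eq_card_orbits (b := hπ.weylBasis h2 hψ hB hB') fun g w => ?_
  rw [hπ.weylBasis_apply, hπ.weylBasis_apply, Representation.linHom_apply, ← hρ]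
  change ω (ρ g) * (π ⟨w, 0⟩ * ω (ρ g⁻¹)) = _
  rw [← mul_assoc, map_inv, hω (ρ g) ⟨w, 0⟩]
  rfl

end Weyl

theorem exists_section_of_bijective_restrict_ker {Γ G Z : Type*} [Group Γ] [Group G] [Group Z]
    {f : Γ →* G} (hf : Function.Surjective f) {χ : Γ →* Z}
    (hχ : Function.Bijective (χ.comp f.ker.subtype)) : ∃ s : G →* Γ, f.comp s = .id G := by
  have hbij : Function.Bijective (f.comp χ.ker.subtype) := by
    constructor
    · rw [injective_iff_map_eq_one]
      intro γ hγ
      have : (⟨γ, hγ⟩ : f.ker) = 1 := hχ.1 (γ.2.trans (map_one _).symm)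
      exact Subtype.ext (congrArg (fun κ : f.ker => (κ : Γ)) this)
    · intro g
      obtain ⟨γ, rfl⟩ := hf g
      obtain ⟨κ, hκ⟩ := hχ.2 (χ γ)
      refine ⟨⟨γ * κ⁻¹, ?_⟩, ?_⟩
      · change χ κ = χ γ at hκ
        simp [MonoidHom.mem_ker, hκ]
      · simp [MonoidHom.mem_ker.1 κ.2]
  let e := MulEquiv.ofBijective _ hbij
  exact ⟨χ.ker.subtype.comp e.symm.toMonoidHom, MonoidHom.ext e.apply_symm_apply⟩

section EigenspaceDet

open Module.End

variable {K V : Type*} [Field K] [AddCommGroup V] [Module K V]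

theorem mapsTo_eigenspace_of_mem_centralizer {P T : (Module.End K V)ˣ} (ε : K)
    (hT : T ∈ Subgroup.centralizer {P}) :
    Set.MapsTo (T : Module.End K V) (eigenspace (P : Module.End K V) ε)
      (eigenspace (P : Module.End K V) ε) :=
  mapsTo_genEigenspace_of_comm (congrArg Units.val (hT P rfl)) ε 1

/-- The determinant on the `ε`-eigenspace of `P`, as a character of the centralizer of `P`. -/
noncomputable def eigenspaceDet (P : (Module.End K V)ˣ) (ε : K) : Subgroup.centralizer {P} →* Kˣ :=
  MonoidHom.toHomUnits
    { toFun T := LinearMap.det (LinearMap.restrict (T : (Module.End K V)ˣ).1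
        (mapsTo_eigenspace_of_mem_centralizer ε T.2))
      map_one' := LinearMap.det_id
      map_mul' S T := by rw [← map_mul]; rfl }

theorem eigenspaceDet_of_eq_smul_one {P : (Module.End K V)ˣ} {T : Subgroup.centralizer {P}} {c : K}
    (hT : (T : (Module.End K V)ˣ).1 = c • 1) (ε : K) :
    (eigenspaceDet P ε T : K) =
      c ^ Module.finrank K (eigenspace (P : Module.End K V) ε) := by
  have : LinearMap.restrict (T : (Module.End K V)ˣ).1
      (mapsTo_eigenspace_of_mem_centralizer ε T.2) = c • LinearMap.id :=
    LinearMap.ext fun v => Subtype.ext (LinearMap.congr_fun hT v)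
  change LinearMap.det _ = _
  rw [this, LinearMap.det_smul, LinearMap.det_id, mul_one]

theorem isProj_eigenspace {P : Module.End K V} (h2 : (2 : K) ≠ 0) (hP : P * P = 1) {ε : K}
    (hε : ε * ε = 1) : LinearMap.IsProj (eigenspace P ε) ((2 : K)⁻¹ • (1 + ε • P)) where
  map_mem v := by
    have hPv : P (P v) = v := LinearMap.congr_fun hP v
    rw [mem_eigenspace_iff]
    simp only [LinearMap.smul_apply, LinearMap.add_apply, Module.End.one_apply, map_smul, map_add,
      hPv]
    linear_combination (norm := module) (-(2 : K)⁻¹) • hε • P v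
  map_id v hv := by
    have := mem_eigenspace_iff.1 hv
    rw [LinearMap.smul_apply, inv_smul_eq_iff₀ h2]
    simp [this, smul_smul, hε, two_smul]

theorem finrank_eigenspace_one_eq_add_one [FiniteDimensional K V] [CharZero K]
    {P : Module.End K V} (hP : P * P = 1) (htr : LinearMap.trace K V P = 1) :
    Module.finrank K (eigenspace P 1) = Module.finrank K (eigenspace P (-1)) + 1 := by
  have h1 := (isProj_eigenspace two_ne_zero hP (one_mul 1)).trace
  have h2 := (isProj_eigenspace two_ne_zero hP (by simp : (-1 : K) * -1 = 1)).trace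
  simp only [map_smul, map_add, LinearMap.trace_one, htr, smul_eq_mul] at h1 h2
  have : (Module.finrank K (eigenspace P 1) : K) = Module.finrank K (eigenspace P (-1)) + 1 := by
    rw [← h1, ← h2]
    ring
  exact_mod_cast this

/-- The character `det₊ / det₋` of the centralizer of an involution `P`, comparing the
determinants on its two eigenspaces. -/
noncomputable def eigenspaceDetRatio (P : (Module.End K V)ˣ) : Subgroup.centralizer {P} →* Kˣ :=
  eigenspaceDet P 1 / eigenspaceDet P (-1)

theorem eigenspaceDetRatio_of_eq_smul_one [FiniteDimensional K V] [CharZero K]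
    {P : (Module.End K V)ˣ} (hP : P * P = 1) (htr : LinearMap.trace K V P = 1)
    {T : Subgroup.centralizer {P}} {c : K} (hT : (T : (Module.End K V)ˣ).1 = c • 1) :
    (eigenspaceDetRatio P T : K) = c := by
  have hplus := eigenspaceDet_of_eq_smul_one hT 1
  have hminus := eigenspaceDet_of_eq_smul_one hT (-1)
  rw [finrank_eigenspace_one_eq_add_one (congrArg Units.val hP) htr, pow_succ, ← hminus] at hplus
  rw [eigenspaceDetRatio, MonoidHom.div_apply, Units.val_div_eq_div_val, hplus,
    mul_div_cancel_left₀ c (Units.ne_zero _)]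

end EigenspaceDet

section Implementers

variable {F W : Type*} [Field F] [AddCommGroup W] [Module F W] {B : LinearMap.BilinForm F W}
  {ψ : AddChar F ℂ} {H : Type*} [AddCommGroup H] [Module ℂ H]
  {π : Representation ℂ (Heisenberg B) H}

/-- The graph of the projective oscillator representation: the pairs `(g, M)` such that
`M π(h) M⁻¹ = π(g(h))` for all `h`. -/
def implementers (π : Representation ℂ (Heisenberg B) H) :
    Subgroup (Sp B × (Module.End ℂ H)ˣ) where
  carrier := {p | ∀ h, p.2 * π h = π (spAct p.1 h) * p.2}
  one_mem' h := by simp [show spAct 1 h = h from rfl]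
  mul_mem' {p q} hp hq h := by
    have hspAct : spAct (p.1 * q.1) h = spAct p.1 (spAct q.1 h) := rfl
    rw [Prod.fst_mul, Prod.snd_mul, Units.val_mul, mul_assoc, hq, ← mul_assoc, hp, mul_assoc,
      hspAct]
  inv_mem' {p} hp h := by
    have hspAct : spAct p.1 (spAct p.1⁻¹ h) = h :=
      Heisenberg.ext (LinearEquiv.apply_symm_apply p.1.1 h.vec) rfl
    rw [Prod.snd_inv, Units.inv_mul_eq_iff_eq_mul, ← mul_assoc, Units.eq_mul_inv_iff_mul_eq]
    rw [Prod.fst_inv, hp, hspAct]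

theorem mem_implementers_of_forall_weyl (hπ : IsHeisenbergRep ψ π)
    {p : Sp B × (Module.End ℂ H)ˣ}
    (hp : ∀ w, (p.2 : Module.End ℂ H) * π ⟨w, 0⟩ = π ⟨(p.1 : W ≃ₗ[F] W) w, 0⟩ * p.2) :
    p ∈ implementers π := fun h => by
  rw [hπ.apply_eq_smul, mul_smul_comm, hp, hπ.apply_eq_smul (spAct p.1 h), smul_mul_assoc]
  rfl

theorem exists_algEquiv_weyl [FiniteDimensional ℂ H] (hπ : IsHeisenbergRep ψ π)
    (h2 : (2 : F) ≠ 0) (hψ : ψ ≠ 1) (hB : B.IsAlt) (hB' : B.SeparatingRight) (g : Sp B) :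
    ∃ L : Module.End ℂ H ≃ₐ[ℂ] Module.End ℂ H,
      ∀ w, L (π ⟨w, 0⟩) = π ⟨(g : W ≃ₗ[F] W) w, 0⟩ := by
  let b := hπ.weylBasis h2 hψ hB hB'
  let L : Module.End ℂ H ≃ₗ[ℂ] Module.End ℂ H := b.equiv b (g : W ≃ₗ[F] W).toEquiv
  have hL (w : W) : L (π ⟨w, 0⟩) = π ⟨(g : W ≃ₗ[F] W) w, 0⟩ := by
    simpa [b] using b.equiv_apply w b (g : W ≃ₗ[F] W).toEquiv
  have hone : L 1 = 1 := by
    rw [← map_one π]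
    exact (hL 0).trans (by rw [map_zero]; rfl)
  have hmul (S T) : L (S * T) = L S * L T := by
    have : (LinearMap.mul ℂ (Module.End ℂ H)).compr₂ L.toLinearMap =
        (LinearMap.mul ℂ (Module.End ℂ H)).compl₁₂ L.toLinearMap L.toLinearMap := by
      refine b.ext fun w => b.ext fun x => ?_
      simp [b, hL, hπ.weyl_mul, g.2 w x]
    exact LinearMap.congr_fun₂ this S T
  exact ⟨AlgEquiv.ofLinearEquiv L hone hmul, hL⟩

/-- By the Skolem–Noether theorem. -/
theorem exists_mem_implementers [FiniteDimensional ℂ H] (hπ : IsHeisenbergRep ψ π)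
    (h2 : (2 : F) ≠ 0) (hψ : ψ ≠ 1) (hB : B.IsAlt) (hB' : B.SeparatingRight) (g : Sp B) :
    ∃ M, (g, M) ∈ implementers π := by
  obtain ⟨L, hL⟩ := exists_algEquiv_weyl hπ h2 hψ hB hB' g
  obtain ⟨M, rfl⟩ := Module.End.mulSemiringActionToAlgEquiv_conjAct_surjective L
  refine ⟨ConjAct.ofConjAct M, mem_implementers_of_forall_weyl hπ fun w => ?_⟩
  rw [← hL, MulSemiringAction.toAlgEquiv_apply, ConjAct.units_smul_def]
  simp [mul_assoc]

theorem exists_eq_smul_one_of_mem_implementers [FiniteDimensional ℂ H] (hπ : IsHeisenbergRep ψ π)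
    {p : Sp B × (Module.End ℂ H)ˣ} (hp : p ∈ implementers π) (hp1 : p.1 = 1) :
    ∃ c : ℂ, (p.2 : Module.End ℂ H) = c • 1 := by
  have := hπ.irreducible
  refine exists_eq_smul_one_of_commute π fun h => ?_
  have := hp h
  rwa [hp1] at this

variable (B) in
theorem neg_mem_Sp : LinearEquiv.neg F ∈ Sp B := fun x y => by simp

theorem commute_of_mem_implementers [FiniteDimensional ℂ H] (hπ : IsHeisenbergRep ψ π)
    {P : (Module.End ℂ H)ˣ} (htr : LinearMap.trace ℂ H P ≠ 0)
    (hP : (⟨LinearEquiv.neg F, neg_mem_Sp B⟩, P) ∈ implementers π)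
    {p : Sp B × (Module.End ℂ H)ˣ} (hp : p ∈ implementers π) : p.2 * P = P * p.2 := by
  have hfst : p.1 * ⟨LinearEquiv.neg F, neg_mem_Sp B⟩ * p.1⁻¹ *
      (⟨LinearEquiv.neg F, neg_mem_Sp B⟩ : Sp B)⁻¹ = 1 := by
    rw [mul_inv_eq_one, mul_inv_eq_iff_eq_mul]
    ext w
    simp
  obtain ⟨c, hc⟩ := exists_eq_smul_one_of_mem_implementers hπ
    (mul_mem (mul_mem (mul_mem hp hP) (inv_mem hp)) (inv_mem hP)) hfst
  have hcomm : (p.2 * P : Module.End ℂ H) = c • (P * p.2) := by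
    have : p.2 * P = p.2 * P * p.2⁻¹ * P⁻¹ * (P * p.2) := by group
    rw [← Units.val_mul, this, Units.val_mul, Units.val_mul P, ← smul_one_mul]
    exact congrArg (· * _) hc
  have htrace : LinearMap.trace ℂ H P = c * LinearMap.trace ℂ H P :=
    calc LinearMap.trace ℂ H P = LinearMap.trace ℂ H (p.2⁻¹ * (p.2 * P)) := by
          rw [Units.inv_mul_cancel_left]
      _ = c * LinearMap.trace ℂ H P := by
          rw [hcomm, mul_smul_comm, map_smul, smul_eq_mul, LinearMap.trace_mul_comm,
            Units.mul_inv_cancel_right]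
  rw [(mul_eq_right₀ htr).1 htrace.symm, one_smul] at hcomm
  exact Units.ext hcomm

theorem exists_section_implementers [FiniteDimensional ℂ H] (hπ : IsHeisenbergRep ψ π)
    (h2 : (2 : F) ≠ 0) (hψ : ψ ≠ 1) (hB : B.IsAlt) (hB' : B.SeparatingRight)
    {P : (Module.End ℂ H)ˣ} (hP : P * P = 1) (htr : LinearMap.trace ℂ H P = 1)
    (hPneg : (⟨LinearEquiv.neg F, neg_mem_Sp B⟩, P) ∈ implementers π) :
    ∃ s : Sp B →* implementers π, ∀ g, (s g).1.1 = g := by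
  let f : implementers π →* Sp B := (MonoidHom.fst _ _).comp (implementers π).subtype
  have hf : Function.Surjective f := fun g =>
    have ⟨M, hM⟩ := exists_mem_implementers hπ h2 hψ hB hB' g
    ⟨⟨(g, M), hM⟩, rfl⟩
  let op : implementers π →* (Module.End ℂ H)ˣ :=
    (MonoidHom.snd _ _).comp (implementers π).subtype
  let χ : implementers π →* ℂˣ := (eigenspaceDetRatio P).comp <|
    op.codRestrict _ fun p => Subgroup.mem_centralizer_singleton_iff.2 <|
      commute_of_mem_implementers hπ (by simp [htr]) hPneg p.2
  have hχ {p} {c : ℂ} (hp : (op p : Module.End ℂ H) = c • 1) : χ p = c :=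
    eigenspaceDetRatio_of_eq_smul_one hP htr hp
  obtain ⟨s, hs⟩ := exists_section_of_bijective_restrict_ker hf (χ := χ) (by
    constructor
    · rw [injective_iff_map_eq_one]
      rintro ⟨p, hp1⟩ hp
      obtain ⟨c, hc⟩ := exists_eq_smul_one_of_mem_implementers hπ p.2 hp1
      have hc1 : c = 1 := by rw [← hχ hc]; exact congrArg Units.val hp
      rw [hc1, one_smul] at hc
      exact Subtype.ext <| Subtype.ext <| Prod.ext hp1 (Units.ext hc)
    · intro z
      refine ⟨⟨⟨(1, z • 1), fun h => ?_⟩, rfl⟩, Units.ext (hχ ?_)⟩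
      · simp [show spAct 1 h = h from rfl, Units.smul_def]
      · rfl)
  exact ⟨s, DFunLike.congr_fun hs⟩

theorem isOscillatorRep_of_section {s : Sp B →* implementers π} (hs : ∀ g, (s g).1.1 = g) :
    IsOscillatorRep π ((Units.coeHom _).comp <|
      (MonoidHom.snd _ _).comp <| (implementers π).subtype.comp s) := fun g h => by
  have hmul : ((s g).1.2 : Module.End ℂ H) * π h = π (spAct g h) * (s g).1.2 := by
    simpa only [hs] using (s g).2 h
  have hinv : (s g⁻¹).1.2 = (s g).1.2⁻¹ := by rw [map_inv]; rfl
  change ((s g).1.2 : Module.End ℂ H) * π h * ((s g⁻¹).1.2 : Module.End ℂ H) = _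
  rw [hinv, Units.mul_inv_eq_iff_eq_mul, hmul]

end Implementers

section Coordinates

variable {F U : Type*} [Field F] [AddCommGroup U] [Module F U]

variable (F U) in
/-- The coordinate `uᵢ` of the tensor `u₀ ⊗ e₀ + u₁ ⊗ e₁`. -/
noncomputable def tensorCoord (i : Fin 2) : U ⊗[F] (Fin 2 → F) →ₗ[F] U :=
  LinearMap.proj i ∘ₗ (TensorProduct.piScalarRight F F U (Fin 2)).toLinearMap

@[simp]
theorem tensorCoord_tmul (i : Fin 2) (u : U) (v : Fin 2 → F) :
    tensorCoord F U i (u ⊗ₜ v) = v i • u := by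
  simp [tensorCoord]

theorem tensor_ext {x y : U ⊗[F] (Fin 2 → F)} (h : ∀ i, tensorCoord F U i x = tensorCoord F U i y) :
    x = y :=
  (TensorProduct.piScalarRight F F U (Fin 2)).injective (funext h)

theorem tensorForm_apply (β : LinearMap.BilinForm F U) (x y : U ⊗[F] (Fin 2 → F)) :
    tensorForm β x y =
      β (tensorCoord F U 0 x) (tensorCoord F U 1 y) -
        β (tensorCoord F U 1 x) (tensorCoord F U 0 y) := by
  induction x using TensorProduct.induction_on with
  | zero => simp
  | add a b ha hb => simp only [map_add, LinearMap.add_apply, ha, hb]; ring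
  | tmul u v =>
    induction y using TensorProduct.induction_on with
    | zero => simp
    | add a b ha hb => simp only [map_add, ha, hb]; ring
    | tmul u' v' =>
      simp only [tensorForm_tmul, planeForm_apply, tensorCoord_tmul, map_smul,
        LinearMap.smul_apply, smul_eq_mul]
      ring

theorem tensorForm_isAlt {β : LinearMap.BilinForm F U} (hβ : β.IsSymm) : (tensorForm β).IsAlt :=
  fun x => by rw [tensorForm_apply, hβ.eq, sub_self]

theorem tensorForm_separatingRight {β : LinearMap.BilinForm F U} (hβ : β.SeparatingRight) :
    (tensorForm β).SeparatingRight := fun y hy => by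
  refine tensor_ext fun i => ?_
  rw [map_zero]
  refine hβ _ fun u => ?_
  fin_cases i
  · simpa [tensorForm_apply] using hy (u ⊗ₜ ![0, 1])
  · simpa [tensorForm_apply] using hy (u ⊗ₜ ![1, 0])

end Coordinates

section Schrodinger

theorem eq_top_of_translation_mem_of_addChar_mul_mem {A : Type*} [AddCommGroup A] [Finite A]
    {S : Submodule ℂ (A → ℂ)} (hS : S ≠ ⊥) (htranslation : ∀ f ∈ S, ∀ a, (fun t => f (t + a)) ∈ S)
    (hmul : ∀ f ∈ S, ∀ χ : AddChar A ℂ, ⇑χ * f ∈ S) : S = ⊤ := by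
  classical
  have hideal (f) (hf : f ∈ S) (k : A → ℂ) : k * f ∈ S := by
    have hk : k ∈ Submodule.span ℂ (Set.range ((⇑) : AddChar A ℂ → A → ℂ)) := by
      rw [← AddChar.coe_complexBasis, (AddChar.complexBasis A).span_eq]
      trivial
    suffices Submodule.span ℂ (Set.range ((⇑) : AddChar A ℂ → A → ℂ)) ≤
        S.comap (LinearMap.mulRight ℂ f) from this hk
    rw [Submodule.span_le]
    rintro _ ⟨χ, rfl⟩
    exact hmul f hf χ
  obtain ⟨f, hf, hf0⟩ := S.exists_mem_ne_zero_of_ne_bot hS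
  obtain ⟨a, ha⟩ := Function.ne_iff.1 hf0
  have hsingle (t : A) : Pi.single t 1 ∈ S := by
    convert hideal _ (htranslation f hf (a - t)) (Pi.single t (f a)⁻¹) using 1
    simp [← Pi.single_mul_left, inv_mul_cancel₀ ha]
  rw [eq_top_iff, ← (Pi.basisFun ℂ A).span_eq, Submodule.span_le]
  rintro _ ⟨t, rfl⟩
  simpa using hsingle t

theorem exists_addChar_eq {F W : Type*} [Field F] [AddCommGroup W] [Module F W] [Finite W]
    {B : LinearMap.BilinForm F W} {ψ : AddChar F ℂ} (hψ : ψ ≠ 1) (hB : B.SeparatingRight)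
    (χ : AddChar W ℂ) : ∃ y, ∀ x, χ x = ψ (B x y) := by
  let φ (y : W) : AddChar W ℂ := ψ.compAddMonoidHom (B.flip y).toAddMonoidHom
  have hφ : Function.Injective φ := by
    intro y z hyz
    by_contra hne
    obtain ⟨w, hw⟩ := exists_addChar_apply_ne_one hψ hB (sub_ne_zero.2 hne)
    have : ψ (B w y) = ψ (B w z) := DFunLike.congr_fun hyz w
    exact hw (by rw [map_sub, AddChar.map_sub_eq_div, this, div_self (ψ.val_isUnit _).ne_zero])
  have hcard : Nat.card W = Nat.card (AddChar W ℂ) := by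
    have := Fintype.ofFinite W
    rw [Nat.card_eq_fintype_card, Nat.card_eq_fintype_card, AddChar.card_eq]
  have hφ' : Function.Surjective φ := ((Nat.bijective_iff_injective_and_card φ).2 ⟨hφ, hcard⟩).2
  obtain ⟨y, rfl⟩ := hφ' χ
  exact ⟨y, fun _ => rfl⟩

variable {F U : Type*} [Field F] [AddCommGroup U] [Module F U] {β : LinearMap.BilinForm F U}

/-- The Schrödinger model of the Heisenberg representation of `U ⊗ F²`: the tensor
`x ⊗ e₀ + y ⊗ e₁` acts on functions by `f ↦ (t ↦ ψ (β t y + β x y / 2) f (t + x))`. -/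
noncomputable def schrodinger (h2 : (2 : F) ≠ 0) (hβ : β.IsSymm) (ψ : AddChar F ℂ) :
    Representation ℂ (Heisenberg (tensorForm β)) (U → ℂ) where
  toFun h :=
    { toFun f t := ψ (h.ctr + β t (tensorCoord F U 1 h.vec) +
          2⁻¹ * β (tensorCoord F U 0 h.vec) (tensorCoord F U 1 h.vec)) *
          f (t + tensorCoord F U 0 h.vec)
      map_add' f k := by ext t; simp [mul_add]
      map_smul' c f := by ext t; simp [mul_left_comm] }
  map_one' := by ext f t; simp
  map_mul' h k := by
    refine LinearMap.ext fun f => funext fun t => ?_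
    simp only [Heisenberg.mul_vec, Heisenberg.mul_ctr, map_add, LinearMap.coe_mk,
      AddHom.coe_mk, Module.End.mul_apply, ← mul_assoc, ← AddChar.map_add_eq_mul, add_assoc t,
      tensorForm_apply, LinearMap.add_apply, hβ.eq (tensorCoord F U 1 h.vec)]
    congr 2
    field_simp
    ring

theorem schrodinger_apply (h2 : (2 : F) ≠ 0) (hβ : β.IsSymm) (ψ : AddChar F ℂ)
    (h : Heisenberg (tensorForm β)) (f : U → ℂ) (t : U) :
    schrodinger h2 hβ ψ h f t =
      ψ (h.ctr + β t (tensorCoord F U 1 h.vec) +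
        2⁻¹ * β (tensorCoord F U 0 h.vec) (tensorCoord F U 1 h.vec)) *
        f (t + tensorCoord F U 0 h.vec) :=
  rfl

theorem schrodinger_isIrreducible [Finite U] (h2 : (2 : F) ≠ 0) (hβ : β.IsSymm)
    (hβ' : β.SeparatingRight) {ψ : AddChar F ℂ} (hψ : ψ ≠ 1) :
    (schrodinger h2 hβ ψ).IsIrreducible := by
  have : Nontrivial (Subrepresentation (schrodinger h2 hβ ψ)) :=
    ⟨⊥, ⊤, fun h => bot_ne_top (congrArg Subrepresentation.toSubmodule h)⟩
  refine ⟨fun S => or_iff_not_imp_left.2 fun hS => ?_⟩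
  have htop : S.toSubmodule = ⊤ := by
    refine eq_top_of_translation_mem_of_addChar_mul_mem ?_ (fun f hf a => ?_) fun f hf χ => ?_
    · exact fun h => hS (Subrepresentation.toSubmodule_injective h)
    · convert S.apply_mem_toSubmodule ⟨a ⊗ₜ ![1, 0], 0⟩ hf using 1
      ext t
      simp [schrodinger_apply]
    · obtain ⟨y, hy⟩ := exists_addChar_eq hψ hβ' χ
      convert S.apply_mem_toSubmodule ⟨y ⊗ₜ ![0, 1], 0⟩ hf using 1
      ext t
      simp [schrodinger_apply, hy]
  exact Subrepresentation.toSubmodule_injective htop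

theorem schrodinger_isHeisenbergRep [Finite U] (h2 : (2 : F) ≠ 0) (hβ : β.IsSymm)
    (hβ' : β.SeparatingRight) {ψ : AddChar F ℂ} (hψ : ψ ≠ 1) :
    IsHeisenbergRep ψ (schrodinger h2 hβ ψ) where
  irreducible := schrodinger_isIrreducible h2 hβ hβ' hψ
  central z f := by ext t; simp [schrodinger_apply]

/-- The parity operator `f ↦ (t ↦ f (-t))`. -/
def parity (U : Type*) [AddCommGroup U] : (Module.End ℂ (U → ℂ))ˣ :=
  LinearMap.GeneralLinearGroup.ofLinearEquiv (LinearEquiv.funCongrLeft ℂ ℂ (Equiv.neg U))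

theorem parity_apply (f : U → ℂ) (t : U) : (parity U : Module.End ℂ (U → ℂ)) f t = f (-t) := rfl

theorem parity_mul_parity : parity U * parity U = 1 := by
  ext f t
  simp [parity_apply]

variable (U) in
theorem trace_parity [Finite U] (h2 : (2 : F) ≠ 0) :
    LinearMap.trace ℂ _ (parity U : Module.End ℂ (U → ℂ)) = 1 := by
  classical
  have := Fintype.ofFinite U
  have hne {t : U} (ht : t ≠ 0) : -t ≠ t := fun h => by
    rw [neg_eq_iff_add_eq_zero, ← two_smul F, smul_eq_zero] at h
    exact h.elim h2 ht
  rw [LinearMap.trace_eq_matrix_trace ℂ (Pi.basisFun ℂ U), Matrix.trace,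
    Finset.sum_eq_single (0 : U) (fun t _ ht => ?_) (by simp)]
  · simp [parity_apply]
  · simp [parity_apply, hne ht]

theorem parity_mem_implementers (h2 : (2 : F) ≠ 0) (hβ : β.IsSymm) (ψ : AddChar F ℂ) :
    (⟨LinearEquiv.neg F, neg_mem_Sp (tensorForm β)⟩, parity U) ∈
      implementers (schrodinger h2 hβ ψ) := by
  intro h
  refine LinearMap.ext fun f => funext fun t => ?_
  simp [parity_apply, schrodinger_apply, spAct, add_comm]

end Schrodinger

section Orbits

theorem natCard_orbits_congr {G X Y : Type*} [Group G] [MulAction G X] [MulAction G Y]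
    (e : X ≃ Y) (he : ∀ (g : G) x, e (g • x) = g • e x) :
    Nat.card (MulAction.orbitRel.Quotient G X) = Nat.card (MulAction.orbitRel.Quotient G Y) :=
  Nat.card_congr <| Quotient.congr e fun x y => by
    simp only [MulAction.orbitRel_apply, MulAction.mem_orbit_iff, ← he, e.apply_eq_iff_eq]

theorem ncard_range_orbit (G X : Type*) [Group G] [MulAction G X] :
    (Set.range (MulAction.orbit G : X → Set X)).ncard =
      Nat.card (MulAction.orbitRel.Quotient G X) := by
  rw [← Nat.card_range_of_injective (MulAction.orbitRel.Quotient.orbit_injective (G := G)),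
    Nat.card_coe_set_eq, ← Quotient.mk_surjective.range_comp]
  rfl

variable {F : Type*} [Field F]

theorem planeForm_smul (u v w : Fin 2 → F) :
    planeForm F u w • v = planeForm F v w • u + planeForm F u v • w := by
  ext i
  fin_cases i <;> simp [planeForm_apply] <;> ring

theorem exists_planeForm_eq_one {u : Fin 2 → F} (hu : u ≠ 0) : ∃ v, planeForm F u v = 1 := by
  obtain ⟨i, hi⟩ := Function.ne_iff.1 hu
  fin_cases i
  · exact ⟨![0, (u 0)⁻¹], by simpa [planeForm_apply] using mul_inv_cancel₀ hi⟩
  · exact ⟨![-(u 1)⁻¹, 0], by simpa [planeForm_apply] using mul_inv_cancel₀ hi⟩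

theorem exists_smul_eq_of_planeForm_eq_one {u v : Fin 2 → F} (h : planeForm F u v = 1) :
    ∃ g : SL(2, F), g • ![1, 0] = u ∧ g • ![0, 1] = v := by
  obtain ⟨g, hg⟩ : ∃ g : SL(2, F), (g : Matrix (Fin 2) (Fin 2) F) = !![u 0, v 0; u 1, v 1] :=
    ⟨⟨_, by rw [Matrix.det_fin_two_of, ← h, planeForm_apply]; ring⟩, rfl⟩
  refine ⟨g, ?_, ?_⟩ <;> ext i <;> fin_cases i <;>
    simp [hg, Matrix.SpecialLinearGroup.smul_def, Matrix.smul_eq_mulVec]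

/-- Representatives of the `SL₂`-orbits on pairs of plane vectors: independent vectors
`e₀, d e₁`, the zero pair, `0, e₀`, and `e₀, a e₀`. -/
def standardPair : Fˣ ⊕ Option (Option F) → (Fin 2 → F) × (Fin 2 → F)
  | .inl d => (![1, 0], (d : F) • ![0, 1])
  | .inr none => (0, 0)
  | .inr (some none) => (0, ![1, 0])
  | .inr (some (some a)) => (![1, 0], a • ![1, 0])

theorem exists_smul_standardPair_eq (p : (Fin 2 → F) × (Fin 2 → F)) :
    ∃ r, ∃ g : SL(2, F), g • standardPair r = p := by
  obtain ⟨u, v⟩ := p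
  simp only [Prod.ext_iff, Prod.smul_fst, Prod.smul_snd]
  by_cases hu : u = 0
  · by_cases hv : v = 0
    · exact ⟨.inr none, 1, by simp [standardPair, hu, hv]⟩
    · obtain ⟨w, hw⟩ := exists_planeForm_eq_one hv
      obtain ⟨g, hg, -⟩ := exists_smul_eq_of_planeForm_eq_one hw
      exact ⟨.inr (some none), g, by simp [standardPair, hu], hg⟩
  by_cases hd : planeForm F u v = 0
  · obtain ⟨w, hw⟩ := exists_planeForm_eq_one hu
    obtain ⟨g, hg, -⟩ := exists_smul_eq_of_planeForm_eq_one hw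
    refine ⟨.inr (some (some (planeForm F v w))), g, hg, ?_⟩
    calc g • planeForm F v w • ![1, 0] = planeForm F v w • u := by rw [smul_comm, hg]
      _ = planeForm F u w • v := by rw [planeForm_smul u v w, hd, zero_smul, add_zero]
      _ = v := by rw [hw, one_smul]
  · obtain ⟨g, hg, hg'⟩ := exists_smul_eq_of_planeForm_eq_one
      (show planeForm F u ((planeForm F u v)⁻¹ • v) = 1 by simp [hd])
    refine ⟨.inl (Units.mk0 _ hd), g, hg, ?_⟩
    calc g • (Units.mk0 _ hd : F) • ![0, 1] = planeForm F u v • (planeForm F u v)⁻¹ • v := by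
          rw [smul_comm, hg', Units.val_mk0]
      _ = v := smul_inv_smul₀ hd v

theorem eq_of_smul_standardPair_eq {g : SL(2, F)} {r s : Fˣ ⊕ Option (Option F)}
    (h : g • standardPair r = standardPair s) : r = s := by
  have hdet : planeForm F (standardPair r).1 (standardPair r).2 =
      planeForm F (standardPair s).1 (standardPair s).2 := by
    rw [← h]
    exact (planeForm_sl g _ _).symm
  obtain ⟨hfst, hsnd⟩ := Prod.ext_iff.1 h
  have hfst_zero : (standardPair r).1 = 0 ↔ (standardPair s).1 = 0 := by
    rw [← hfst, Prod.smul_fst, smul_eq_zero_iff_eq]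
  have hsnd_zero : (standardPair r).2 = 0 ↔ (standardPair s).2 = 0 := by
    rw [← hsnd, Prod.smul_snd, smul_eq_zero_iff_eq]
  rcases r with d | _ | _ | a <;> rcases s with d' | _ | _ | a'
  case inl.inl =>
    have hd : (d : F) = d' := by simpa [standardPair, planeForm_apply] using hdet
    exact congrArg _ (Units.ext hd)
  case inr.some.some.inr.some.some =>
    have heq : a • (![1, 0] : Fin 2 → F) = a' • ![1, 0] := by
      have he₀ : g • (![1, 0] : Fin 2 → F) = ![1, 0] := hfst
      calc a • (![1, 0] : Fin 2 → F) = g • a • ![1, 0] := by rw [smul_comm, he₀]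
        _ = a' • ![1, 0] := hsnd
    simpa using congrFun heq 0
  all_goals
    simp [standardPair, planeForm_apply, (Units.ne_zero _).symm] at hdet hfst_zero hsnd_zero ⊢

theorem natCard_orbits_plane_pairs [Finite F] :
    Nat.card (MulAction.orbitRel.Quotient SL(2, F) ((Fin 2 → F) × (Fin 2 → F))) =
      2 * Nat.card F + 1 := by
  have hbij : Function.Bijective fun r : Fˣ ⊕ Option (Option F) =>
      (⟦standardPair r⟧ : MulAction.orbitRel.Quotient SL(2, F) _) := by
    refine ⟨fun r s hrs => ?_, fun q => ?_⟩
    · obtain ⟨g, hg⟩ := MulAction.orbitRel_apply.1 (Quotient.exact hrs)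
      exact (eq_of_smul_standardPair_eq hg).symm
    · obtain ⟨p, rfl⟩ := Quotient.exists_rep q
      obtain ⟨r, g, rfl⟩ := exists_smul_standardPair_eq p
      exact ⟨r, Quotient.sound (MulAction.orbitRel_apply.2 ⟨g⁻¹, inv_smul_smul g _⟩)⟩
  rw [← Nat.card_eq_of_bijective _ hbij, Nat.card_sum, Finite.card_option, Finite.card_option,
    Nat.card_units]
  have := Nat.card_pos (α := F)
  lia

theorem diagOrbit_eq_orbit (p : (Fin 2 → F) × (Fin 2 → F)) :
    diagOrbit p = MulAction.orbit SL(2, F) p := rfl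

end Orbits

section Oscillator

variable {F U : Type*} [Field F] [AddCommGroup U] [Module F U]

theorem exists_linearEquiv_prod_plane (hU : Module.finrank F U = 2)
    (β : LinearMap.BilinForm F U) :
    ∃ e : U ⊗[F] (Fin 2 → F) ≃ₗ[F] (Fin 2 → F) × (Fin 2 → F),
      ∀ (g : SL(2, F)) x, e ((slToSp β g : _ ≃ₗ[F] _) x) = g • e x := by
  have := Module.finite_of_finrank_eq_succ hU
  let b := Module.finBasisOfFinrankEq F U hU
  let e := TensorProduct.congr b.equivFun (LinearEquiv.refl F (Fin 2 → F)) ≪≫ₗ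
    TensorProduct.comm F _ _ ≪≫ₗ TensorProduct.piScalarRight F F _ _ ≪≫ₗ
    LinearEquiv.finTwoArrow F (Fin 2 → F)
  refine ⟨e, fun g x => ?_⟩
  induction x using TensorProduct.induction_on with
  | zero => simp
  | add x y hx hy => simp only [map_add, hx, hy, smul_add]
  | tmul u v =>
    have htmul (v) : e (u ⊗ₜ v) = (b.repr u 0 • v, b.repr u 1 • v) := by simp [e]
    change e (u ⊗ₜ (g • v)) = _
    rw [htmul, htmul, Prod.smul_mk, smul_comm g (b.repr u 0),
      smul_comm g (b.repr u 1)]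

theorem IsOscillatorRep.intertwiningNumber_comp_slToSp [Finite F] (h2 : (2 : F) ≠ 0)
    (hU : Module.finrank F U = 2) {β : LinearMap.BilinForm F U} (hβ : β.IsSymm)
    (hβ' : β.SeparatingRight) {ψ : AddChar F ℂ} (hψ : ψ ≠ 1)
    {H : Type*} [AddCommGroup H] [Module ℂ H]
    {π : Representation ℂ (Heisenberg (tensorForm β)) H}
    {ω : Representation ℂ (Sp (tensorForm β)) H} (hω : IsOscillatorRep π ω)
    (hπ : IsHeisenbergRep ψ π) :
    intertwiningNumber (ω.comp (slToSp β)) (ω.comp (slToSp β)) = 2 * Nat.card F + 1 := by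
  obtain ⟨e, he⟩ := exists_linearEquiv_prod_plane hU β
  have : Finite (U ⊗[F] (Fin 2 → F)) := Finite.of_equiv _ e.toEquiv.symm
  have := hπ.finiteDimensional
  let _ : MulAction SL(2, F) (U ⊗[F] (Fin 2 → F)) := MulAction.compHom _ (slToSp β)
  rw [hω.intertwiningNumber_eq_card_orbits hπ h2 hψ (tensorForm_isAlt hβ)
      (tensorForm_separatingRight hβ') (slToSp β) fun _ _ => rfl,
    natCard_orbits_congr e.toEquiv he, natCard_orbits_plane_pairs]

theorem ncard_range_diagOrbit [Finite F] :
    (Set.range (diagOrbit (F := F))).ncard = 2 * Nat.card F + 1 := by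
  rw [funext diagOrbit_eq_orbit, ncard_range_orbit, natCard_orbits_plane_pairs]

theorem exists_isOscillatorRep_schrodinger [Finite U] (h2 : (2 : F) ≠ 0)
    {β : LinearMap.BilinForm F U} (hβ : β.IsSymm) (hβ' : β.SeparatingRight) {ψ : AddChar F ℂ}
    (hψ : ψ ≠ 1) : ∃ ω, IsOscillatorRep (schrodinger h2 hβ ψ) ω := by
  obtain ⟨s, hs⟩ := exists_section_implementers (schrodinger_isHeisenbergRep h2 hβ hβ' hψ) h2 hψ
    (tensorForm_isAlt hβ) (tensorForm_separatingRight hβ') parity_mul_parity (trace_parity U h2)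
    (parity_mem_implementers h2 hβ ψ)
  exact ⟨_, isOscillatorRep_of_section hs⟩

end Oscillator

theorem proposition4 {F : Type*} [Field F] [Finite F] (hF : ringChar F ≠ 2)
    {U : Type*} [AddCommGroup U] [Module F U] (hU : Module.finrank F U = 2)
    (β : LinearMap.BilinForm F U) (hsymm : β.IsSymm) (hnondeg : β.Nondegenerate)
    (ψ : AddChar F ℂ) (hψ : ψ ≠ 1) :
    (∃ (π : Representation ℂ (Heisenberg (tensorForm β)) (U → ℂ))
        (ω : Representation ℂ (Sp (tensorForm β)) (U → ℂ)),
        IsHeisenbergRep ψ π ∧ IsOscillatorRep π ω) ∧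
    (∀ {H : Type*} [AddCommGroup H] [Module ℂ H]
        (π : Representation ℂ (Heisenberg (tensorForm β)) H)
        (ω : Representation ℂ (Sp (tensorForm β)) H),
        IsHeisenbergRep ψ π → IsOscillatorRep π ω →
        intertwiningNumber (ω.comp (slToSp β)) (ω.comp (slToSp β)) = 2 * Nat.card F + 1) ∧
    (Set.range (diagOrbit (F := F))).ncard = 2 * Nat.card F + 1 := by
  have h2 : (2 : F) ≠ 0 := Ring.two_ne_zero hF
  have : Module.Finite F U := Module.finite_of_finrank_eq_succ hU
  have : Finite U := Module.finite_of_finite F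
  obtain ⟨ω, hω⟩ := exists_isOscillatorRep_schrodinger h2 hsymm hnondeg.2 hψ
  exact ⟨⟨_, ω, schrodinger_isHeisenbergRep h2 hsymm hnondeg.2 hψ, hω⟩,
    fun _ _ hπ hω => hω.intertwiningNumber_comp_slToSp h2 hU hsymm hnondeg.2 hψ hπ,
    ncard_range_diagOrbit⟩
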